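/- Let $\mathcal X$ be a measurable space with a $\sigma$-finite reference measure $dx'$, let $B>0$, and let $D$ be a probability distribution on $\mathcal X\times[-B,B]$. For each $x\in\mathcal X$ let $N^{\mathsf{mir}}_x$ (the mirrored neighborhood of $x$) be a probability distribution on $\mathcal X$ that depends measurably on $x$ and has a density $p_{N^{\mathsf{mir}}_x}$ with respect to $dx'$. Let $\mathcal F$ and $\mathcal G_{\mathrm{local}}$ be classes of functions $\mathcal X\to[-B,B]$, and let $\mathcal G$ be a class of measurable functions $g:\mathcal X\times\mathcal X\to[-B,B]$, $(x',x)\mapsto g_{x'}(x)$, such that $g_{x'}\in\mathcal G_{\mathrm{local}}$ for all $g\in\mathcal G$ and $x'\in\mathcal X$. Assume that $\mathcal G$ is separable: there is a countable $\mathcal G_0\subseteq\mathcal G$ such that for each $g\in\mathcal G$ there are $g^{(n)}\in\mathcal G_0$ with $g^{(n)}_{x'}(x)\to g_{x'}(x)$ for every $x\in\mathcal X$ and $N^{\mathsf{mir}}_x$-almost every $x'$. For a sample $S=((x_1,y_1),\dots,(x_m,y_m))$ put $$\rho_S:=\int_{\mathcal X}\sqrt{\frac1m\sum_{i=1}^m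 p_{N^{\mathsf{mir}}_{x_i}}(x')^2}\,dx',\qquad \mathsf{MNF}(f,g,x):=\mathbb E_{x'\sim N^{\mathsf{mir}}_x}\big[(f(x)-g_{x'}(x))^2\big],$$ $$\hat{\mathcal R}^*_S(\mathcal G_{\mathrm{local}}):=\max_{\emptyset\ne T\subseteq\{1,\dots,m\}}\sqrt{\frac{|T|}{m}}\;\hat{\mathcal R}_T(\mathcal G_{\mathrm{local}}),\qquad \hat{\mathcal R}_T(\mathcal G_{\mathrm{local}}):=\mathbb E_{\sigma}\Big[\sup_{h\in\mathcal G_{\mathrm{local}}}\frac1{|T|}\sum_{i\in T}\sigma_i h(x_i)\Big],$$ where $\sigma$ is uniform on $\{-1,1\}^T$. Let $m\ge1$ and $0<\delta<1$. Then with probability at least $1-\delta$ over $S\sim D^m$, for all $f\in\mathcal F$ and all $g\in\mathcal G$, $$\mathbb E_{(x,y)\sim D}\,\mathbb E_{x'\sim N^{\mathsf{mir}}_x}\big[(g_{x'}(x)-y)^2\big]\le\frac2m\sum_{i=1}^m(f(x_i)-y_i)^2+\frac2m\sum_{i=1}^m\mathsf{MNF}(f,g,x_i)+8B\,\rho_S\,\hat{\mathcal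 R}^*_S(\mathcal G_{\mathrm{local}})\,(\ln m+1)+12B^2\sqrt{\frac{\ln(1/\delta)}{2m}}.$$ (If the set of samples for which this holds is not measurable, the claim is that its complement has outer probability at most $\delta$.) -/

import Mathlib

open MeasureTheory ProbabilityTheory Filter Topology

noncomputable section

namespace LocalExplain

variable {X : Type*}

/-- Empirical Rademacher complexity of a class `H` of real functions on the finite sample
`x = (x_i)_{i ∈ ι}`: the average, over uniform signs `σ ∈ {-1, 1}^ι`, of
`sup_{h ∈ H} (1 / |ι|) ∑ i, σ_i h(x_i)`. -/
def empRademacher {ι : Type*} [Fintype ι] [DecidableEq ι] (H : Set (X → ℝ)) (x : ι → X) : ℝ :=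
  (∑ σ : ι → ℤˣ,
      ⨆ h : H, (1 / (Fintype.card ι : ℝ)) * ∑ i, ((σ i : ℤ) : ℝ) * (h : X → ℝ) (x i)) /
    2 ^ Fintype.card ι

/-- The corrected empirical Rademacher complexity: the maximum over all nonempty subsamples `T`
of the sample `x_1, …, x_m` of `R_T(H) * √(|T| / m)`. -/
def empRademacherStar {m : ℕ} (H : Set (X → ℝ)) (x : Fin m → X) : ℝ :=
  ⨆ T : {T : Finset (Fin m) // T.Nonempty},
    empRademacher H (fun i : T.1 => x i) * √((T.1.card : ℝ) / (m : ℝ))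

variable [MeasurableSpace X]

/-- The density at `x'`, with respect to the reference measure `ν`, of the mirrored neighborhood
distribution `N x`. -/
def mirDensity (ν : Measure X) (N : Kernel X X) (x x' : X) : ℝ :=
  ((N x).rnDeriv ν x').toReal

/-- The disjointedness factor of the sample `x_1, …, x_m`. -/
def disjointedness (ν : Measure X) (N : Kernel X X) {m : ℕ} (x : Fin m → X) : ℝ :=
  ∫ x', √((1 / (m : ℝ)) * ∑ i, mirDensity ν N (x i) x' ^ 2) ∂ν

/-- Mirrored neighborhood fidelity of `f` and `g` at the target point `x`
(`g x' x` is the value at `x` of the local explanation at the source point `x'`). -/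
def mnfAt (N : Kernel X X) (f : X → ℝ) (g : X → X → ℝ) (x : X) : ℝ :=
  ∫ x', (f x - g x' x) ^ 2 ∂(N x)

/-- Test squared error of the randomized explainer `g_{x'}(x)`, `x' ∼ N x`. -/
def explainerTestMSE (D : Measure (X × ℝ)) (N : Kernel X X) (g : X → X → ℝ) : ℝ :=
  ∫ z, ∫ x', (g x' z.1 - z.2) ^ 2 ∂(N z.1) ∂D

/-- Separability of the class of randomized explainers, the usual measurability convention for
suprema over a class: there is a countable subclass such that every member of the class is the
limit of a sequence from the subclass, at every target point `x` and for almost every source point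
`x' ∼ N x`. -/
def IsSeparableClass (N : Kernel X X) (G : Set (X → X → ℝ)) : Prop :=
  ∃ G₀ : Set (X → X → ℝ), G₀ ⊆ G ∧ G₀.Countable ∧
    ∀ g ∈ G, ∃ u : ℕ → X → X → ℝ, (∀ n, u n ∈ G₀) ∧
      ∀ x, ∀ᵐ x' ∂(N x), Tendsto (fun n => u n x' x) atTop (𝓝 (g x' x))

end LocalExplain

end

/-! For a labelled point z = (x, y) let L_g(z) be the mean of (g_{x'}(x) - y)² over x' ∼ N x, a
number in [0, 4B²]. A one-sided Rademacher bound for the class of the L_g, together with (g - y)² ≤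
2(f - y)² + 2(f - g)² on the sample, leaves only the Rademacher complexity of the L_g to be
estimated.

The uniform bound (`measure_uniformDeviation_le`) applies McDiarmid once, to the supremal deviation
minus twice the empirical complexity. Symmetrization makes its mean nonpositive and its increments
are 3c/n, so a single δ is spent and the constant is 3c with c = 4B².

For the complexity (`lossRademacher_explainerLoss_le`), each L_g is an integral against ν with
weight p_i(x'), and the supremum moves inside the integral. At a fixed x' only the local function
g_{x'} matters. Contraction (`sum_iSup_signs_contraction`) replaces the weighted squared loss by 4B
p_i(x') g_{x'}(x_i). To remove the weights (`sum_iSup_weighted_le`), sort them decreasingly and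
write them as a nonnegative combination of indicators of top-k sets. Each such set costs √(m k)
times the corrected complexity. Summation by parts and Cauchy-Schwarz then give √(∑ p_i²) times at
most ln m + 1, and integrating √(∑ p_i²) over x' gives √m times the disjointedness factor. -/

/-! ### Contraction for sign averages -/

theorem sum_int_units (f : ℤˣ → ℝ) : ∑ s : ℤˣ, f s = f 1 + f (-1) := by
  rw [show (Finset.univ : Finset ℤˣ) = {1, -1} from rfl, Finset.sum_pair (by decide)]

theorem bddAbove_range_of_abs_le {H : Type*} {f : H → ℝ} {C : ℝ} (hf : ∀ h, |f h| ≤ C) :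
    BddAbove (Set.range f) :=
  ⟨C, by rintro _ ⟨h, rfl⟩; exact (abs_le.1 (hf h)).2⟩

theorem abs_intUnits (s : ℤˣ) : |((s : ℤ) : ℝ)| = 1 := by
  rcases Int.units_eq_one_or s with rfl | rfl <;> simp

theorem abs_sum_signs_le {ι : Type*} (T : Finset ι) (σ : ι → ℤˣ) {a : ι → ℝ} {C : ℝ}
    (ha : ∀ i, |a i| ≤ C) : |∑ i ∈ T, ((σ i : ℤ) : ℝ) * a i| ≤ T.card * C := by
  refine (Finset.abs_sum_le_sum_abs _ _).trans ?_
  rw [← nsmul_eq_mul]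
  refine Finset.sum_le_card_nsmul _ _ _ fun i _ => ?_
  rw [abs_mul, abs_intUnits, one_mul]
  exact ha i

/-- The two-point case of the contraction principle. -/
theorem iSup_add_iSup_sub_le {H : Type*} [Nonempty H] {v a b : H → ℝ}
    {Cv Cb : ℝ} (hv : ∀ h, |v h| ≤ Cv) (hb : ∀ h, |b h| ≤ Cb)
    (hab : ∀ h h', |a h - a h'| ≤ |b h - b h'|) :
    (⨆ h, (v h + a h)) + ⨆ h, (v h - a h) ≤ (⨆ h, (v h + b h)) + ⨆ h, (v h - b h) := by
  have b1 : BddAbove (Set.range fun h => v h + b h) :=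
    bddAbove_range_of_abs_le fun h => (abs_add_le _ _).trans (add_le_add (hv h) (hb h))
  have b2 : BddAbove (Set.range fun h => v h - b h) :=
    bddAbove_range_of_abs_le fun h => (abs_sub _ _).trans (add_le_add (hv h) (hb h))
  refine ciSup_add_ciSup_le fun h h' => ?_
  have h1 := le_ciSup b1 h
  have h1' := le_ciSup b1 h'
  have h2 := le_ciSup b2 h
  have h2' := le_ciSup b2 h'
  have h3 := (le_abs_self _).trans (hab h h')
  -- The sign of `b h - b h'` decides which of `h`, `h'` is tested in the plus supremum and which in
  -- the minus one.
  rcases abs_cases (b h - b h') with ⟨h4, -⟩ | ⟨h4, -⟩ <;> linarith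

/-- The Ledoux-Talagrand contraction principle, with an offset `u`. -/
theorem sum_iSup_signs_contraction {H : Type*} [Nonempty H] :
    ∀ (n : ℕ) (u : H → ℝ) (a b : H → Fin n → ℝ) (Cu Ca Cb : ℝ),
      (∀ h, |u h| ≤ Cu) → (∀ h i, |a h i| ≤ Ca) → (∀ h i, |b h i| ≤ Cb) →
      (∀ h h' i, |a h i - a h' i| ≤ |b h i - b h' i|) →
      ∑ σ : Fin n → ℤˣ, ⨆ h, (u h + ∑ i, ((σ i : ℤ) : ℝ) * a h i) ≤
        ∑ σ : Fin n → ℤˣ, ⨆ h, (u h + ∑ i, ((σ i : ℤ) : ℝ) * b h i) := by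
  intro n
  induction n with
  | zero => intros; simp
  | succ n ih =>
    intro u a b Cu Ca Cb hu ha hb hab
    -- Peel off the sign of coordinate 0; its term joins the offset, which is why the induction
    -- carries `u`.
    have key : ∀ c : H → Fin (n + 1) → ℝ,
        ∑ σ : Fin (n + 1) → ℤˣ, ⨆ h, (u h + ∑ i, ((σ i : ℤ) : ℝ) * c h i) =
        ∑ s : ℤˣ, ∑ σ : Fin n → ℤˣ,
          ⨆ h, ((u h + ((s : ℤ) : ℝ) * c h 0) + ∑ i, ((σ i : ℤ) : ℝ) * c h i.succ) := by
      intro c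
      rw [← (Fin.consEquiv (fun _ => ℤˣ)).sum_comp, Fintype.sum_prod_type]
      simp [Fin.consEquiv, Fin.sum_univ_succ, add_assoc]
    rw [key, key]
    calc _ ≤ ∑ s : ℤˣ, ∑ σ : Fin n → ℤˣ,
          ⨆ h, ((u h + ((s : ℤ) : ℝ) * a h 0) + ∑ i, ((σ i : ℤ) : ℝ) * b h i.succ) := by
          refine Finset.sum_le_sum fun s _ => ?_
          refine ih (fun h => u h + ((s : ℤ) : ℝ) * a h 0) (fun h i => a h i.succ)
            (fun h i => b h i.succ) (Cu + Ca) Ca Cb (fun h => ?_) (fun h i => ha h _)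
            (fun h i => hb h _) (fun h h' i => hab h h' _)
          refine (abs_add_le _ _).trans (add_le_add (hu h) ?_)
          rw [abs_mul, abs_intUnits, one_mul]
          exact ha h 0
      _ ≤ _ := by
          -- With the other signs fixed, everything except coordinate 0 plays the role of `v` in the
          -- two-point case.
          rw [Finset.sum_comm, Finset.sum_comm (s := (Finset.univ : Finset ℤˣ))]
          refine Finset.sum_le_sum fun σ _ => ?_
          rw [sum_int_units, sum_int_units]
          have := iSup_add_iSup_sub_le (v := fun h => u h + ∑ i, ((σ i : ℤ) : ℝ) * b h i.succ)
            (a := fun h => a h 0) (b := fun h => b h 0) (Cv := Cu + (n : ℝ) * Cb) (Cb := Cb)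
            (fun h => (abs_add_le _ _).trans (add_le_add (hu h)
              (by simpa using abs_sum_signs_le Finset.univ σ (fun i => hb h (Fin.succ i)))))
            (fun h => hb h 0) (fun h h' => hab h h' 0)
          have e1 : ∀ c : H → ℝ, (fun h => u h + (((1 : ℤˣ) : ℤ) : ℝ) * c h +
              ∑ i, ((σ i : ℤ) : ℝ) * b h i.succ) =
              fun h => (u h + ∑ i, ((σ i : ℤ) : ℝ) * b h i.succ) + c h := by
            intro c; funext h; push_cast; ring
          have e2 : ∀ c : H → ℝ, (fun h => u h + (((-1 : ℤˣ) : ℤ) : ℝ) * c h +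
              ∑ i, ((σ i : ℤ) : ℝ) * b h i.succ) =
              fun h => (u h + ∑ i, ((σ i : ℤ) : ℝ) * b h i.succ) - c h := by
            intro c; funext h; push_cast; ring
          simp only [iSup] at this ⊢
          rw [e1 (fun h => a h 0), e1 (fun h => b h 0), e2 (fun h => a h 0), e2 (fun h => b h 0)]
          exact this

/-! ### Removal of weights by sorting and summation by parts -/

/-- Summation by parts for a decreasing sequence of weights against square roots. -/
theorem sum_sub_mul_sqrt (P : ℕ → ℝ) (n : ℕ) :
    ∑ k ∈ Finset.range n, (P k - P (k + 1)) * √((k + 1 : ℕ) : ℝ) =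
      ∑ k ∈ Finset.range n, P k * (√((k + 1 : ℕ) : ℝ) - √(k : ℝ)) - P n * √(n : ℝ) := by
  induction n with
  | zero => simp
  | succ n ih => rw [Finset.sum_range_succ, ih, Finset.sum_range_succ]; ring

/-- Since √k ≤ √(k+1), the product (√(k+1) - √k)√(k+1) is at most (k+1) - k = 1. -/
theorem sqrt_succ_sub_sqrt_sq_le (k : ℕ) :
    (√((k + 1 : ℕ) : ℝ) - √(k : ℝ)) ^ 2 ≤ ((k : ℝ) + 1)⁻¹ := by
  have hk : (0 : ℝ) ≤ k := k.cast_nonneg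
  have h1 : √((k + 1 : ℕ) : ℝ) ^ 2 = k + 1 := by
    rw [Real.sq_sqrt (by positivity)]; push_cast; ring
  have h2 : √(k : ℝ) ^ 2 = k := Real.sq_sqrt hk
  have h3 : √(k : ℝ) ≤ √((k + 1 : ℕ) : ℝ) := Real.sqrt_le_sqrt (by push_cast; linarith)
  have h0 : 0 ≤ √(k : ℝ) := Real.sqrt_nonneg _
  have h4 : (√((k + 1 : ℕ) : ℝ) - √(k : ℝ)) * √((k + 1 : ℕ) : ℝ) ≤ 1 := by nlinarith
  have h5 : 0 ≤ (√((k + 1 : ℕ) : ℝ) - √(k : ℝ)) * √((k + 1 : ℕ) : ℝ) :=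
    mul_nonneg (by linarith) (by positivity)
  rw [← one_div, le_div_iff₀ (by positivity), ← h1, ← mul_pow]
  exact pow_le_one₀ h5 h4

/-- The sum of squares is below the harmonic number, hence below ln m + 1; as this is at least 1, it
also bounds the square root. -/
theorem sum_sqrt_succ_sub_sqrt_sq_le (m : ℕ) :
    √(∑ k ∈ Finset.range m, (√((k + 1 : ℕ) : ℝ) - √(k : ℝ)) ^ 2) ≤ Real.log m + 1 := by
  have hl : 0 ≤ Real.log m := Real.log_natCast_nonneg m
  have h1 : ∑ k ∈ Finset.range m, (√((k + 1 : ℕ) : ℝ) - √(k : ℝ)) ^ 2 ≤ Real.log m + 1 := by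
    have := harmonic_le_one_add_log m
    rw [harmonic] at this
    push_cast at this
    have h2 : ∑ k ∈ Finset.range m, (√((k + 1 : ℕ) : ℝ) - √(k : ℝ)) ^ 2 ≤
      ∑ k ∈ Finset.range m, ((k : ℝ) + 1)⁻¹ :=
      Finset.sum_le_sum fun k _ => sqrt_succ_sub_sqrt_sq_le k
    linarith
  rw [Real.sqrt_le_left (by positivity)]
  nlinarith

/-- Rademacher sums with nonnegative weights are controlled by the unweighted sums over
subsamples. -/
theorem sum_iSup_weighted_le {H : Type*} [Nonempty H] {m : ℕ}
    {p : Fin m → ℝ} (hp : ∀ i, 0 ≤ p i) {a : H → Fin m → ℝ} {C K : ℝ}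
    (ha : ∀ h i, |a h i| ≤ C) (hK : 0 ≤ K)
    (hT : ∀ T : Finset (Fin m), T.Nonempty →
      ∑ σ : Fin m → ℤˣ, ⨆ h, ∑ i ∈ T, ((σ i : ℤ) : ℝ) * a h i ≤ K * √(T.card : ℝ)) :
    ∑ σ : Fin m → ℤˣ, ⨆ h, ∑ i, ((σ i : ℤ) : ℝ) * (p i * a h i) ≤
      K * (√(∑ i, p i ^ 2) * (Real.log m + 1)) := by
  obtain ⟨e, he⟩ : ∃ e : Equiv.Perm (Fin m), Antitone (p ∘ e) :=
    ⟨Tuple.sort (fun i => - p i), fun i j hij => by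
      have := Tuple.monotone_sort (fun i => - p i) hij
      simpa using this⟩
  -- The sorted weights, padded by 0 so that telescoping to index `m` leaves no boundary term.
  set P : ℕ → ℝ := fun k => if h : k < m then p (e ⟨k, h⟩) else 0 with hP
  have hPm : P m = 0 := by simp [hP]
  have hPanti : ∀ k, 0 ≤ P k - P (k + 1) := by
    intro k
    simp only [hP]
    split_ifs with h1 h2 h2
    · exact sub_nonneg.2 (he (by simp [Fin.le_def] : (⟨k, h1⟩ : Fin m) ≤ ⟨k + 1, h2⟩))
    · simpa using hp _
    · omega
    · simp
  -- The `k + 1` indices of largest weight, as ranks start at 0.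
  set T : ℕ → Finset (Fin m) := fun k => Finset.univ.filter fun i => (e.symm i : ℕ) ≤ k with hTdef
  have hcard : ∀ k ∈ Finset.range m, (T k).card = k + 1 := by
    intro k hk
    rw [Finset.mem_range] at hk
    have : T k = (Finset.Iic (⟨k, hk⟩ : Fin m)).map e.toEmbedding := by
      ext i
      simp [hTdef, Finset.mem_map_equiv, Fin.le_def]
    rw [this, Finset.card_map, Fin.card_Iic]
  have hdecomp : ∀ i, p i =
      ∑ k ∈ Finset.range m, if (e.symm i : ℕ) ≤ k then P k - P (k + 1) else 0 := by
    intro i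
    rw [← Finset.sum_filter, show (Finset.range m).filter (fun k => (e.symm i : ℕ) ≤ k) =
      Finset.Ico (e.symm i : ℕ) m by ext k; simp [and_comm],
      Finset.sum_Ico_eq_sum_range]
    have := Finset.sum_range_sub' (fun k => P ((e.symm i : ℕ) + k)) (m - (e.symm i : ℕ))
    simp only [← add_assoc] at this
    rw [this, Nat.add_sub_cancel' (e.symm i).2.le, hPm]
    simp [hP]
  have hbdd : ∀ (S : Finset (Fin m)) (σ : Fin m → ℤˣ),
      BddAbove (Set.range fun h => ∑ i ∈ S, ((σ i : ℤ) : ℝ) * a h i) := fun S σ =>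
    bddAbove_range_of_abs_le fun h => abs_sum_signs_le S σ (ha h)
  calc ∑ σ : Fin m → ℤˣ, ⨆ h, ∑ i, ((σ i : ℤ) : ℝ) * (p i * a h i)
      ≤ ∑ σ : Fin m → ℤˣ, ∑ k ∈ Finset.range m,
          (P k - P (k + 1)) * ⨆ h, ∑ i ∈ T k, ((σ i : ℤ) : ℝ) * a h i := by
        -- The layer coefficients are nonnegative, so the supremum can be taken layer by layer.
        refine Finset.sum_le_sum fun σ _ => ciSup_le fun h => ?_
        have : ∑ i, ((σ i : ℤ) : ℝ) * (p i * a h i) =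
            ∑ k ∈ Finset.range m, (P k - P (k + 1)) * ∑ i ∈ T k, ((σ i : ℤ) : ℝ) * a h i := by
          simp only [hTdef, Finset.sum_filter, Finset.mul_sum]
          rw [Finset.sum_comm]
          refine Finset.sum_congr rfl fun i _ => ?_
          conv_lhs => rw [hdecomp i]
          rw [Finset.sum_mul, Finset.mul_sum]
          refine Finset.sum_congr rfl fun k _ => ?_
          split_ifs <;> ring
        rw [this]
        exact Finset.sum_le_sum fun k _ =>
          mul_le_mul_of_nonneg_left (le_ciSup (hbdd _ σ) h) (hPanti k)
    _ = ∑ k ∈ Finset.range m, (P k - P (k + 1)) *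
          ∑ σ : Fin m → ℤˣ, ⨆ h, ∑ i ∈ T k, ((σ i : ℤ) : ℝ) * a h i := by
        rw [Finset.sum_comm]; simp only [Finset.mul_sum]
    _ ≤ ∑ k ∈ Finset.range m, (P k - P (k + 1)) * (K * √((k + 1 : ℕ) : ℝ)) := by
        refine Finset.sum_le_sum fun k hk => mul_le_mul_of_nonneg_left ?_ (hPanti k)
        rw [← hcard k hk]
        exact hT _ (Finset.card_pos.1 (by rw [hcard k hk]; omega))
    _ = K * ∑ k ∈ Finset.range m, P k * (√((k + 1 : ℕ) : ℝ) - √(k : ℝ)) := by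
        have := sum_sub_mul_sqrt P m
        rw [hPm, zero_mul, sub_zero] at this
        rw [← this, Finset.mul_sum]
        exact Finset.sum_congr rfl fun k _ => by ring
    _ ≤ K * (√(∑ k ∈ Finset.range m, P k ^ 2) *
          √(∑ k ∈ Finset.range m, (√((k + 1 : ℕ) : ℝ) - √(k : ℝ)) ^ 2)) :=
        mul_le_mul_of_nonneg_left (Real.sum_mul_le_sqrt_mul_sqrt _ _ _) hK
    _ ≤ _ := by
        have : ∑ k ∈ Finset.range m, P k ^ 2 = ∑ i, p i ^ 2 := by
          rw [Finset.sum_range]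
          simpa [hP] using Equiv.sum_comp e fun i => p i ^ 2
        rw [this]
        gcongr
        exact sum_sqrt_succ_sub_sqrt_sq_le m

/-- Averaging over the signs outside a subsample changes nothing. -/
theorem sum_signs_restrict {m : ℕ} (T : Finset (Fin m)) (F : (T → ℤˣ) → ℝ) :
    (∑ σ : Fin m → ℤˣ, F fun i => σ i) / 2 ^ m = (∑ σ : T → ℤˣ, F σ) / 2 ^ T.card := by
  rw [← (Equiv.piEquivPiSubtypeProd (· ∈ T) (fun _ => ℤˣ)).symm.sum_comp, Fintype.sum_prod_type]
  have : ∀ (σ : T → ℤˣ) (τ : {i // i ∉ T} → ℤˣ),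
      F (fun i : T => (Equiv.piEquivPiSubtypeProd (· ∈ T) (fun _ => ℤˣ)).symm (σ, τ) i) = F σ := by
    intro σ τ
    congr 1
    funext i
    simp [Equiv.piEquivPiSubtypeProd]
  simp only [this, Finset.sum_const, nsmul_eq_mul, ← Finset.mul_sum]
  have hc : T.card ≤ m := by simpa using T.card_le_univ
  have h2 : (Finset.univ : Finset ({i // i ∉ T} → ℤˣ)).card = 2 ^ (m - T.card) := by
    simp [Finset.card_univ]
  rw [h2, div_eq_div_iff (by positivity) (by positivity)]
  push_cast
  have : (2 : ℝ) ^ m = 2 ^ (m - T.card) * 2 ^ T.card := by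
    rw [← pow_add, Nat.sub_add_cancel hc]
  rw [this]; ring

/-! ### Rademacher complexity of the local class -/

namespace LocalExplain

variable {X : Type*}

theorem sum_signs_linear_eq_zero {ι : Type*} [Fintype ι] [DecidableEq ι] (c : ι → ℝ) :
    ∑ σ : ι → ℤˣ, ∑ i, ((σ i : ℤ) : ℝ) * c i = 0 := by
  have h : ∑ σ : ι → ℤˣ, ∑ i, ((σ i : ℤ) : ℝ) * c i =
      ∑ σ : ι → ℤˣ, ∑ i, (((-σ) i : ℤ) : ℝ) * c i :=
    (Equiv.sum_comp (Equiv.neg (ι → ℤˣ)) fun σ : ι → ℤˣ => ∑ i, ((σ i : ℤ) : ℝ) * c i).symm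
  simp only [Pi.neg_apply, Units.val_neg, Int.cast_neg, neg_mul, Finset.sum_neg_distrib] at h
  linarith

theorem empRademacher_eq {ι : Type*} [Fintype ι] [DecidableEq ι] (H : Set (X → ℝ)) (x : ι → X) :
    empRademacher H x = (1 / (Fintype.card ι : ℝ)) *
      ((∑ σ : ι → ℤˣ, ⨆ h : H, ∑ i, ((σ i : ℤ) : ℝ) * (h : X → ℝ) (x i)) /
        2 ^ Fintype.card ι) := by
  rw [empRademacher, ← mul_div_assoc, Finset.mul_sum]
  simp only [Real.mul_iSup_of_nonneg (one_div_nonneg.2 (Nat.cast_nonneg (Fintype.card ι)))]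

/-- The supremum dominates any fixed member, whose signed sum averages to zero. -/
theorem empRademacher_nonneg {ι : Type*} [Fintype ι] [DecidableEq ι] {H : Set (X → ℝ)} {B : ℝ}
    (hH : ∀ h ∈ H, ∀ x, |h x| ≤ B) (hne : H.Nonempty) (x : ι → X) : 0 ≤ empRademacher H x := by
  obtain ⟨h₀, hh₀⟩ := hne
  rw [empRademacher_eq]
  refine mul_nonneg (by positivity) (div_nonneg ?_ (by positivity))
  rw [← sum_signs_linear_eq_zero fun i => h₀ (x i)]
  refine Finset.sum_le_sum fun σ _ => ?_
  exact le_ciSup (f := fun h : H => ∑ i, ((σ i : ℤ) : ℝ) * (h : X → ℝ) (x i))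
    (bddAbove_range_of_abs_le fun h => abs_sum_signs_le Finset.univ σ fun i => hH h h.2 (x i))
    ⟨h₀, hh₀⟩

theorem empRademacher_mul_le_star {m : ℕ} (H : Set (X → ℝ)) (x : Fin m → X)
    (T : Finset (Fin m)) (hT : T.Nonempty) :
    empRademacher H (fun i : T => x i) * √((T.card : ℝ) / (m : ℝ)) ≤ empRademacherStar H x :=
  le_ciSup (f := fun T : {T : Finset (Fin m) // T.Nonempty} =>
    empRademacher H (fun i : T.1 => x i) * √((T.1.card : ℝ) / (m : ℝ)))
    (Set.finite_range _).bddAbove ⟨T, hT⟩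

theorem empRademacherStar_nonneg {m : ℕ} (hm : 0 < m) {H : Set (X → ℝ)} {B : ℝ}
    (hH : ∀ h ∈ H, ∀ x, |h x| ≤ B) (hne : H.Nonempty) (x : Fin m → X) :
    0 ≤ empRademacherStar H x :=
  (mul_nonneg (empRademacher_nonneg hH hne _) (Real.sqrt_nonneg _)).trans
    (empRademacher_mul_le_star H x {⟨0, hm⟩} (Finset.singleton_nonempty _))

/-- The unnormalised Rademacher sum of a subclass over a subsample is controlled by the corrected
Rademacher complexity. -/
theorem sum_iSup_subsample_le {m : ℕ} (hm : 0 < m) {H : Set (X → ℝ)} {B : ℝ}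
    (hH : ∀ h ∈ H, ∀ x, |h x| ≤ B) {ι : Type*} [Nonempty ι] {a : ι → X → ℝ} (ha : ∀ j, a j ∈ H)
    (x : Fin m → X) (T : Finset (Fin m)) (hT : T.Nonempty) :
    ∑ σ : Fin m → ℤˣ, ⨆ j, ∑ i ∈ T, ((σ i : ℤ) : ℝ) * a j (x i) ≤
      (2 ^ m * √(m : ℝ) * empRademacherStar H x) * √(T.card : ℝ) := by
  have hm' : (0 : ℝ) < m := by exact_mod_cast hm
  have hc : (0 : ℝ) < T.card := by exact_mod_cast hT.card_pos
  have h1 : ∑ σ : Fin m → ℤˣ, ⨆ j, ∑ i ∈ T, ((σ i : ℤ) : ℝ) * a j (x i) ≤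
      ∑ σ : Fin m → ℤˣ, ⨆ h : H, ∑ i : T, ((σ i : ℤ) : ℝ) * (h : X → ℝ) (x i) := by
    refine Finset.sum_le_sum fun σ _ => ciSup_le fun j => ?_
    have := le_ciSup (f := fun h : H => ∑ i : T, ((σ i : ℤ) : ℝ) * (h : X → ℝ) (x i))
      (bddAbove_range_of_abs_le fun h =>
        abs_sum_signs_le Finset.univ (fun i : T => σ i) fun i => hH h h.2 (x i)) ⟨a j, ha j⟩
    rwa [Finset.sum_coe_sort T fun i => ((σ i : ℤ) : ℝ) * a j (x i)] at this
  have h2 := sum_signs_restrict T fun τ : T → ℤˣ =>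
    ⨆ h : H, ∑ i : T, ((τ i : ℤ) : ℝ) * (h : X → ℝ) (x i)
  have h3 := empRademacher_mul_le_star H x T hT
  rw [empRademacher_eq, Fintype.card_coe, ← h2, Real.sqrt_div (by positivity)] at h3
  refine h1.trans ?_
  set A := ∑ σ : Fin m → ℤˣ, ⨆ h : H, ∑ i : T, ((σ i : ℤ) : ℝ) * (h : X → ℝ) (x i)
  have hs : √(T.card : ℝ) * √(T.card : ℝ) = T.card := Real.mul_self_sqrt hc.le
  -- Isolates the normalized quantity that `h3` bounds by the corrected complexity.
  have hA : A = 2 ^ m * √(m : ℝ) *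
      (1 / (T.card : ℝ) * (A / 2 ^ m) * (√(T.card : ℝ) / √(m : ℝ))) * √(T.card : ℝ) := by
    have : √(m : ℝ) ≠ 0 := by positivity
    field_simp
    rw [pow_two, hs]
  rw [hA]
  gcongr

/-- Contraction of the weighted squared losses, and removal of the weights. -/
theorem sum_iSup_weighted_sq_le {m : ℕ} (hm : 0 < m) {H : Set (X → ℝ)} {B : ℝ} (hB : 0 < B)
    (hH : ∀ h ∈ H, ∀ x, |h x| ≤ B) {ι : Type*} [Nonempty ι] {a : ι → X → ℝ} (ha : ∀ j, a j ∈ H)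
    (x : Fin m → X) {y : Fin m → ℝ} (hy : ∀ i, |y i| ≤ B) {p : Fin m → ℝ} (hp : ∀ i, 0 ≤ p i) :
    ∑ σ : Fin m → ℤˣ, ⨆ j, ∑ i, ((σ i : ℤ) : ℝ) * (p i * (a j (x i) - y i) ^ 2) ≤
      4 * B * ((2 ^ m * √(m : ℝ) * empRademacherStar H x) *
        (√(∑ i, p i ^ 2) * (Real.log m + 1))) := by
  have hne : H.Nonempty := ⟨_, ha (Classical.arbitrary ι)⟩
  have haB : ∀ j i, |a j (x i)| ≤ B := fun j i => hH _ (ha j) _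
  set M := ∑ i, p i
  have hpM : ∀ i, p i ≤ M := fun i => Finset.single_le_sum (fun i _ => hp i) (Finset.mem_univ i)
  have hM : 0 ≤ M := Finset.sum_nonneg fun i _ => hp i
  have hw := sum_iSup_weighted_le hp (a := fun j i => a j (x i)) haB
    (mul_nonneg (by positivity) (empRademacherStar_nonneg hm hH hne x))
    (fun T hT => sum_iSup_subsample_le hm hH ha x T hT)
  have hcon := sum_iSup_signs_contraction (H := ι) m (fun _ => 0)
    (fun j i => p i * (a j (x i) - y i) ^ 2) (fun j i => 4 * B * (p i * a j (x i))) 0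
    (M * (2 * B) ^ 2) (4 * B * (M * B)) (by simp)
    (fun j i => by
      rw [abs_mul, abs_of_nonneg (hp i), abs_pow]
      have : |a j (x i) - y i| ≤ 2 * B := (abs_sub _ _).trans (by linarith [haB j i, hy i])
      gcongr
      exact hpM i)
    (fun j i => by
      rw [abs_mul (4 * B), abs_mul (p i), abs_of_nonneg (hp i),
        abs_of_pos (by positivity : 0 < 4 * B)]
      gcongr
      exacts [hpM i, haB j i])
    -- Factoring the difference of squares gives (u - v)(u + v - 2y), and |u + v - 2y| ≤ 4B is the
    -- Lipschitz constant.
    (fun j j' i => by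
      have e1 : p i * (a j (x i) - y i) ^ 2 - p i * (a j' (x i) - y i) ^ 2 =
        p i * ((a j (x i) - a j' (x i)) * (a j (x i) + a j' (x i) - 2 * y i)) := by ring
      have e2 : 4 * B * (p i * a j (x i)) - 4 * B * (p i * a j' (x i)) =
        p i * ((a j (x i) - a j' (x i)) * (4 * B)) := by ring
      simp only [e1, e2]
      rw [abs_mul, abs_mul, abs_mul, abs_mul, abs_of_pos (by positivity : 0 < 4 * B)]
      gcongr
      have h1 := abs_le.1 (haB j i)
      have h2 := abs_le.1 (haB j' i)
      have h3 := abs_le.1 (hy i)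
      exact abs_le.2 ⟨by linarith, by linarith⟩)
  simp only [zero_add] at hcon
  refine hcon.trans ?_
  have : ∀ σ : Fin m → ℤˣ, ⨆ j, ∑ i, ((σ i : ℤ) : ℝ) * (4 * B * (p i * a j (x i))) =
      4 * B * ⨆ j, ∑ i, ((σ i : ℤ) : ℝ) * (p i * a j (x i)) := by
    intro σ
    rw [Real.mul_iSup_of_nonneg (by positivity)]
    simp only [Finset.mul_sum, mul_left_comm]
  simp only [this, ← Finset.mul_sum]
  gcongr

end LocalExplain

/-! ### McDiarmid's inequality -/

section McDiarmid

variable {Z : Type*} [MeasurableSpace Z]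

theorem integrable_of_abs_le {μ : Measure Z} [IsFiniteMeasure μ] {f : Z → ℝ} (hf : Measurable f)
    {C : ℝ} (hC : ∀ z, |f z| ≤ C) : Integrable f μ :=
  Integrable.of_bound hf.aestronglyMeasurable C (Eventually.of_forall hC)

theorem integrable_exp_mul_of_abs_le {μ : Measure Z} [IsFiniteMeasure μ] {f : Z → ℝ}
    (hf : Measurable f) {C : ℝ} (hC : ∀ z, |f z| ≤ C) (t : ℝ) :
    Integrable (fun z => Real.exp (t * f z)) μ := by
  refine integrable_of_abs_le (by fun_prop) (C := Real.exp (|t| * C)) fun z => ?_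
  rw [abs_of_pos (Real.exp_pos _), Real.exp_le_exp]
  refine (le_abs_self _).trans ?_
  rw [abs_mul]
  exact mul_le_mul_of_nonneg_left (hC z) (abs_nonneg t)

/-- Hoeffding's lemma for a function of oscillation at most `c`. -/
theorem integral_exp_le_of_oscillation (μ : Measure Z) [IsProbabilityMeasure μ] {f : Z → ℝ}
    (hf : Measurable f) {C c : ℝ} (hC : ∀ z, |f z| ≤ C) (hc : ∀ z z', f z' - f z ≤ c) (t : ℝ) :
    ∫ z, Real.exp (t * f z) ∂μ ≤ Real.exp (t * ∫ z, f z ∂μ + c ^ 2 * t ^ 2 / 8) := by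
  have : Nonempty Z := nonempty_of_isProbabilityMeasure μ
  have hbdd : BddBelow (Set.range f) :=
    ⟨-C, by rintro _ ⟨z, rfl⟩; exact (abs_le.1 (hC z)).1⟩
  have hmem : ∀ z, f z ∈ Set.Icc (⨅ z, f z) ((⨅ z, f z) + c) := fun z =>
    ⟨ciInf_le hbdd z, by
      have : f z - c ≤ ⨅ z, f z := le_ciInf fun z' => by linarith [hc z' z]
      linarith⟩
  have h := (hasSubgaussianMGF_of_mem_Icc (μ := μ) hf.aemeasurable
    (Eventually.of_forall hmem)).mgf_le t
  -- An interval of length `c` has variance proxy (c/2)².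
  have hcc : (((‖(⨅ z, f z) + c - ⨅ z, f z‖₊ / 2) ^ 2 : NNReal) : ℝ) * t ^ 2 / 2 =
      c ^ 2 * t ^ 2 / 8 := by
    push_cast
    rw [add_sub_cancel_left, div_pow, Real.norm_eq_abs, sq_abs]
    ring
  rw [hcc] at h
  rw [Real.exp_add, mul_comm]
  have e : ∀ z, Real.exp (t * f z) =
      Real.exp (t * (f z - ∫ z, f z ∂μ)) * Real.exp (t * ∫ z, f z ∂μ) := fun z => by
    rw [← Real.exp_add]; ring_nf
  simp only [e, integral_mul_const]
  exact mul_le_mul_of_nonneg_right h (Real.exp_pos _).le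

theorem integral_pi_succ (μ : Measure Z) [IsProbabilityMeasure μ] {n : ℕ}
    {g : (Fin (n + 1) → Z) → ℝ} (hg : Integrable g (Measure.pi fun _ => μ)) :
    ∫ z, g z ∂(Measure.pi fun _ => μ) =
      ∫ z, ∫ w, g (Fin.cons z w) ∂(Measure.pi fun _ : Fin n => μ) ∂μ := by
  have h := (measurePreserving_piFinSuccAbove (fun _ : Fin (n + 1) => μ) 0).symm
  rw [← h.integral_comp', integral_prod]
  · simp [MeasurableEquiv.piFinSuccAbove, Fin.insertNthEquiv]
  · exact (h.integrable_comp_emb (MeasurableEquiv.measurableEmbedding _)).2 hg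

theorem measurable_finCons {n : ℕ} :
    Measurable fun q : Z × (Fin n → Z) => (Fin.cons q.1 q.2 : Fin (n + 1) → Z) := by
  refine measurable_pi_iff.2 fun i => ?_
  refine Fin.cases ?_ (fun j => ?_) i
  · simpa using measurable_fst
  · simpa [Function.comp_def] using (measurable_pi_apply j).comp measurable_snd

/-- McDiarmid's inequality, moment generating function form. -/
theorem integral_exp_le_of_boundedDifferences (μ : Measure Z) [IsProbabilityMeasure μ] {c : ℝ}
    (t : ℝ) : ∀ (n : ℕ) (f : (Fin n → Z) → ℝ) (C : ℝ), Measurable f → (∀ z, |f z| ≤ C) →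
      (∀ z i w, f (Function.update z i w) - f z ≤ c) →
      ∫ z, Real.exp (t * f z) ∂(Measure.pi fun _ => μ) ≤
        Real.exp (t * ∫ z, f z ∂(Measure.pi fun _ => μ) + n * (c ^ 2 * t ^ 2 / 8)) := by
  intro n
  induction n with
  | zero =>
    intro f C _ _ _
    simp [Measure.pi_of_empty (fun _ : Fin 0 => μ)]
  | succ n ih =>
    intro f C hf hC hc
    have hf' : Measurable fun q : Z × (Fin n → Z) => f (Fin.cons q.1 q.2) :=
      hf.comp measurable_finCons
    have hsec : ∀ z, Measurable fun w : Fin n → Z => f (Fin.cons z w) := fun z =>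
      hf'.comp measurable_prodMk_left
    rw [integral_pi_succ μ (integrable_exp_mul_of_abs_le hf hC t),
      integral_pi_succ μ (integrable_of_abs_le hf hC)]
    -- Conditional mean given the first coordinate. It inherits the oscillation bound `c`, so
    -- Hoeffding's lemma handles `G` and induction handles the remaining coordinates.
    set G : Z → ℝ := fun z => ∫ w, f (Fin.cons z w) ∂(Measure.pi fun _ : Fin n => μ)
    have hG : Measurable G := (hf'.stronglyMeasurable.integral_prod_right').measurable
    have hGC : ∀ z, |G z| ≤ C := fun z => by
      have := norm_integral_le_of_norm_le_const (μ := Measure.pi fun _ : Fin n => μ)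
        (f := fun w => f (Fin.cons z w)) (Eventually.of_forall fun w => hC _)
      simpa using this
    have hGc : ∀ z z', G z' - G z ≤ c := fun z z' => by
      rw [← integral_sub (integrable_of_abs_le (hsec z') fun w => hC _)
        (integrable_of_abs_le (hsec z) fun w => hC _)]
      refine (integral_mono (g := fun _ => c)
        ((integrable_of_abs_le (hsec z') fun w => hC _).sub
        (integrable_of_abs_le (hsec z) fun w => hC _)) (integrable_const c) fun w => ?_).trans
        (by simp)
      have := hc (Fin.cons z w) 0 z'
      rwa [Fin.update_cons_zero] at this
    have hin : ∀ z, ∫ w, Real.exp (t * f (Fin.cons z w)) ∂(Measure.pi fun _ : Fin n => μ) ≤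
        Real.exp (n * (c ^ 2 * t ^ 2 / 8)) * Real.exp (t * G z) := fun z => by
      rw [← Real.exp_add, add_comm (_ * _) (t * G z)]
      refine ih (fun w => f (Fin.cons z w)) C (hsec z) (fun w => hC _) fun w i v => ?_
      have := hc (Fin.cons z w) i.succ v
      rwa [← Fin.cons_update] at this
    have hm : Measurable fun z =>
        ∫ w, Real.exp (t * f (Fin.cons z w)) ∂(Measure.pi fun _ : Fin n => μ) :=
      ((hf'.const_mul t).exp.stronglyMeasurable.integral_prod_right').measurable
    have hI := (integrable_exp_mul_of_abs_le (μ := μ) hG hGC t).const_mul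
      (Real.exp (n * (c ^ 2 * t ^ 2 / 8)))
    have hnn : ∀ z, 0 ≤ ∫ w, Real.exp (t * f (Fin.cons z w)) ∂(Measure.pi fun _ : Fin n => μ) :=
      fun z => integral_nonneg fun w => (Real.exp_pos _).le
    calc _ ≤ ∫ z, Real.exp (n * (c ^ 2 * t ^ 2 / 8)) * Real.exp (t * G z) ∂μ :=
          integral_mono_of_nonneg (Eventually.of_forall hnn) hI (Eventually.of_forall hin)
      _ ≤ Real.exp (n * (c ^ 2 * t ^ 2 / 8)) *
          Real.exp (t * ∫ z, G z ∂μ + c ^ 2 * t ^ 2 / 8) := by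
          rw [integral_const_mul]
          exact mul_le_mul_of_nonneg_left (integral_exp_le_of_oscillation μ hG hGC hGc t)
            (Real.exp_pos _).le
      _ = _ := by
          rw [← Real.exp_add]; push_cast; ring_nf

/-- McDiarmid's inequality, tail form, for a function with nonpositive mean. -/
theorem measure_ge_le_of_boundedDifferences (μ : Measure Z) [IsProbabilityMeasure μ] {n : ℕ}
    (hn : 0 < n) {c C ε : ℝ} (hc0 : 0 < c) (hε : 0 ≤ ε) {f : (Fin n → Z) → ℝ} (hf : Measurable f)
    (hC : ∀ z, |f z| ≤ C) (hc : ∀ z i w, f (Function.update z i w) - f z ≤ c)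
    (hmean : ∫ z, f z ∂(Measure.pi fun _ => μ) ≤ 0) :
    (Measure.pi fun _ => μ) {z | ε ≤ f z} ≤
      ENNReal.ofReal (Real.exp (-(2 * ε ^ 2 / (n * c ^ 2)))) := by
  have hn' : (0 : ℝ) < n := by exact_mod_cast hn
  -- The minimizer of -tε + n c² t²/8.
  set t : ℝ := 4 * ε / (n * c ^ 2)
  have ht : 0 ≤ t := by positivity
  have h1 := measure_ge_le_exp_mul_mgf (μ := Measure.pi fun _ : Fin n => μ) ε ht
    (integrable_exp_mul_of_abs_le hf hC t)
  have h2 := integral_exp_le_of_boundedDifferences μ t n f C hf hC hc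
  rw [← ofReal_measureReal]
  refine ENNReal.ofReal_le_ofReal (h1.trans ?_)
  calc _ ≤ Real.exp (-t * ε) * Real.exp (0 + n * (c ^ 2 * t ^ 2 / 8)) := by
        refine mul_le_mul_of_nonneg_left (h2.trans (Real.exp_le_exp.2 ?_)) (Real.exp_pos _).le
        gcongr
        exact mul_nonpos_of_nonneg_of_nonpos ht hmean
    _ = _ := by
        rw [← Real.exp_add]
        congr 1
        simp only [t]
        field_simp
        ring

end McDiarmid

/-! ### Symmetrization and the uniform deviation bound -/

section UniformDeviation

variable {Z H : Type*}

theorem ciSup_le_ciSup_add [Nonempty H] {f g : H → ℝ} {K : ℝ} (hg : BddAbove (Set.range g))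
    (h : ∀ j, f j ≤ g j + K) : ⨆ j, f j ≤ (⨆ j, g j) + K :=
  ciSup_le fun j => (h j).trans (by linarith [le_ciSup hg j])

theorem abs_ciSup_le [Nonempty H] {f : H → ℝ} {C : ℝ} (h : ∀ j, |f j| ≤ C) : |⨆ j, f j| ≤ C := by
  obtain ⟨j⟩ := ‹Nonempty H›
  have : Nonempty H := ⟨j⟩
  exact abs_le.2 ⟨(abs_le.1 (h j)).1.trans (le_ciSup (bddAbove_range_of_abs_le h) j),
    ciSup_le fun j => (abs_le.1 (h j)).2⟩

theorem sum_update_eq {n : ℕ} (F : Fin n → Z → ℝ) (z : Fin n → Z) (i : Fin n) (w : Z) :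
    ∑ j, F j (Function.update z i w j) = ∑ j, F j (z j) + (F i w - F i (z i)) := by
  rw [Fintype.sum_eq_add_sum_compl i, Fintype.sum_eq_add_sum_compl i fun j => F j (z j)]
  have : ∑ j ∈ {i}ᶜ, F j (Function.update z i w j) = ∑ j ∈ {i}ᶜ, F j (z j) :=
    Finset.sum_congr rfl fun j hj => by
      rw [Function.update_of_ne (by simpa using hj)]
  rw [this, Function.update_self]
  ring

/-- The signed empirical supremum `sup_h (1/n) ∑ i, σ_i ℓ_h(z_i)`. -/
noncomputable def signedSup (ℓ : H → Z → ℝ) {n : ℕ} (σ : Fin n → ℤˣ) (z : Fin n → Z) : ℝ :=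
  ⨆ h, (1 / (n : ℝ)) * ∑ i, ((σ i : ℤ) : ℝ) * ℓ h (z i)

/-- The empirical Rademacher complexity of the indexed family `ℓ`. -/
noncomputable def lossRademacher (ℓ : H → Z → ℝ) {n : ℕ} (z : Fin n → Z) : ℝ :=
  (∑ σ : Fin n → ℤˣ, signedSup ℓ σ z) / 2 ^ n

theorem abs_signed_average_le {n : ℕ} (hn : 0 < n) (σ : Fin n → ℤˣ) {a : Fin n → ℝ} {C : ℝ}
    (ha : ∀ i, |a i| ≤ C) : |(1 / (n : ℝ)) * ∑ i, ((σ i : ℤ) : ℝ) * a i| ≤ C := by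
  have hn' : (0 : ℝ) < n := by exact_mod_cast hn
  have := abs_sum_signs_le Finset.univ σ ha
  rw [abs_mul, abs_of_pos (by positivity), one_div, inv_mul_le_iff₀ hn']
  simpa using this

theorem abs_average_le {n : ℕ} (hn : 0 < n) {a : Fin n → ℝ} {C : ℝ}
    (ha : ∀ i, |a i| ≤ C) : |(1 / (n : ℝ)) * ∑ i, a i| ≤ C := by
  simpa using abs_signed_average_le hn (fun _ => 1) ha

variable {ℓ : H → Z → ℝ} {c : ℝ}

theorem abs_signedSup_le [Nonempty H] (hC : ∀ h z, |ℓ h z| ≤ c) {n : ℕ} (hn : 0 < n) (σ : Fin n → ℤˣ)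
    (z : Fin n → Z) : |signedSup ℓ σ z| ≤ c :=
  abs_ciSup_le fun h => abs_signed_average_le hn σ fun i => hC h (z i)

theorem abs_lossRademacher_le [Nonempty H] (hC : ∀ h z, |ℓ h z| ≤ c) {n : ℕ} (hn : 0 < n) (z : Fin n → Z) :
    |lossRademacher ℓ z| ≤ c := by
  rw [lossRademacher, abs_div, abs_of_pos (by positivity : (0 : ℝ) < 2 ^ n),
    div_le_iff₀ (by positivity)]
  refine (Finset.abs_sum_le_sum_abs _ _).trans
    ((Finset.sum_le_card_nsmul _ _ c fun σ _ => abs_signedSup_le hC hn σ z).trans ?_)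
  simp [Finset.card_univ, mul_comm]

/-- The oscillation bound yields the increment c/n, where |ℓ| ≤ c alone would give 2c/n; `hC` only
keeps the suprema bounded. -/
theorem signedSup_le_update [Nonempty H] (hC : ∀ h z, |ℓ h z| ≤ c) (hosc : ∀ h z w, |ℓ h w - ℓ h z| ≤ c)
    {n : ℕ} (hn : 0 < n) (σ : Fin n → ℤˣ) (z : Fin n → Z) (i : Fin n) (w : Z) :
    signedSup ℓ σ z ≤ signedSup ℓ σ (Function.update z i w) + c / n := by
  have hn' : (0 : ℝ) < n := by exact_mod_cast hn
  refine ciSup_le_ciSup_add (bddAbove_range_of_abs_le fun h =>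
    abs_signed_average_le hn σ fun j => hC h _) fun h => ?_
  rw [sum_update_eq (fun j v => ((σ j : ℤ) : ℝ) * ℓ h v), ← mul_sub, mul_add, add_assoc,
    le_add_iff_nonneg_right]
  have h1 : |((σ i : ℤ) : ℝ) * (ℓ h w - ℓ h (z i))| ≤ c := by
    rw [abs_mul, abs_intUnits, one_mul]; exact hosc _ _ _
  have h2 := mul_le_mul_of_nonneg_left (neg_le_of_abs_le h1) (one_div_nonneg.2 hn'.le)
  have h3 : (1 / (n : ℝ)) * -c + c / n = 0 := by ring
  linarith

theorem lossRademacher_le_update [Nonempty H] (hC : ∀ h z, |ℓ h z| ≤ c) (hosc : ∀ h z w, |ℓ h w - ℓ h z| ≤ c)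
    {n : ℕ} (hn : 0 < n) (z : Fin n → Z) (i : Fin n) (w : Z) :
    lossRademacher ℓ z ≤ lossRademacher ℓ (Function.update z i w) + c / n := by
  rw [lossRademacher, lossRademacher, div_add' _ _ _ (by positivity)]
  gcongr
  refine (Finset.sum_le_sum fun σ _ => signedSup_le_update hC hosc hn σ z i w).trans ?_
  rw [Finset.sum_add_distrib]
  simp [Finset.card_univ, mul_comm]

/-- The deviation between a sample and an independent ghost sample, with signs. -/
noncomputable def ghostSup (ℓ : H → Z → ℝ) {n : ℕ} (σ : Fin n → ℤˣ)
    (q : (Fin n → Z) × (Fin n → Z)) : ℝ :=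
  ⨆ h, (1 / (n : ℝ)) * ∑ i, ((σ i : ℤ) : ℝ) * (ℓ h (q.1 i) - ℓ h (q.2 i))

theorem abs_ghostSup_le [Nonempty H] (hosc : ∀ h z w, |ℓ h w - ℓ h z| ≤ c) {n : ℕ} (hn : 0 < n)
    (σ : Fin n → ℤˣ) (q : (Fin n → Z) × (Fin n → Z)) : |ghostSup ℓ σ q| ≤ c :=
  abs_ciSup_le fun h => abs_signed_average_le hn σ fun _ => hosc h _ _

/-- The minus sign on the second sample is absorbed into `-σ`, which is again uniform. -/
theorem ghostSup_le [Nonempty H] (hC : ∀ h z, |ℓ h z| ≤ c) {n : ℕ} (hn : 0 < n)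
    (σ : Fin n → ℤˣ) (q : (Fin n → Z) × (Fin n → Z)) :
    ghostSup ℓ σ q ≤ signedSup ℓ σ q.1 + signedSup ℓ (-σ) q.2 := by
  refine ciSup_le fun h => ?_
  have hb : ∀ (τ : Fin n → ℤˣ) (z : Fin n → Z),
      (1 / (n : ℝ)) * ∑ i, ((τ i : ℤ) : ℝ) * ℓ h (z i) ≤ signedSup ℓ τ z := fun τ z =>
    le_ciSup (f := fun h => (1 / (n : ℝ)) * ∑ i, ((τ i : ℤ) : ℝ) * ℓ h (z i))
      (bddAbove_range_of_abs_le fun h => abs_signed_average_le hn τ fun j => hC h _) h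
  refine le_trans (le_of_eq ?_) (add_le_add (hb σ q.1) (hb (-σ) q.2))
  rw [← mul_add, ← Finset.sum_add_distrib]
  congr 1
  refine Finset.sum_congr rfl fun i _ => ?_
  simp
  ring

variable [MeasurableSpace Z]

/-- Here and below, countability of `H` makes the suprema measurable. -/
theorem measurable_signedSup [Countable H] (hℓ : ∀ h, Measurable (ℓ h)) {n : ℕ}
    (σ : Fin n → ℤˣ) : Measurable (signedSup ℓ σ) := by
  unfold signedSup
  exact Measurable.iSup fun h => Measurable.const_mul (Finset.measurable_sum _ fun i _ =>
    ((hℓ h).comp (measurable_pi_apply i)).const_mul _) _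

theorem measurable_lossRademacher [Countable H] (hℓ : ∀ h, Measurable (ℓ h)) {n : ℕ} :
    Measurable (lossRademacher ℓ (n := n)) := by
  unfold lossRademacher
  exact (Finset.measurable_sum _ fun σ _ => measurable_signedSup hℓ σ).div_const _

variable (μ : Measure Z)

/-- The largest one-sided deviation of an empirical mean from its expectation. -/
noncomputable def supDeviation (ℓ : H → Z → ℝ) {n : ℕ} (z : Fin n → Z) : ℝ :=
  ⨆ h, (∫ w, ℓ h w ∂μ - (1 / (n : ℝ)) * ∑ i, ℓ h (z i))

theorem measurable_supDeviation [Countable H] (hℓ : ∀ h, Measurable (ℓ h)) {n : ℕ} :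
    Measurable (supDeviation μ ℓ (n := n)) := by
  unfold supDeviation
  exact Measurable.iSup fun h => measurable_const.sub (Measurable.const_mul
    (Finset.measurable_sum _ fun i _ => (hℓ h).comp (measurable_pi_apply i)) _)

variable [IsProbabilityMeasure μ]

theorem abs_integral_le (hC : ∀ h z, |ℓ h z| ≤ c) (h : H) : |∫ w, ℓ h w ∂μ| ≤ c := by
  simpa using norm_integral_le_of_norm_le_const (μ := μ) (f := ℓ h)
    (Eventually.of_forall fun w => hC h w)

theorem abs_integral_sub_average_le (hC : ∀ h z, |ℓ h z| ≤ c) {n : ℕ} (hn : 0 < n)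
    (z : Fin n → Z) (h : H) :
    |∫ w, ℓ h w ∂μ - (1 / (n : ℝ)) * ∑ i, ℓ h (z i)| ≤ c + c :=
  (abs_sub _ _).trans (add_le_add (abs_integral_le μ hC h) (abs_average_le hn fun _ => hC _ _))

theorem supDeviation_update_le [Nonempty H] (hC : ∀ h z, |ℓ h z| ≤ c) (hosc : ∀ h z w, |ℓ h w - ℓ h z| ≤ c)
    {n : ℕ} (hn : 0 < n) (z : Fin n → Z) (i : Fin n) (w : Z) :
    supDeviation μ ℓ (Function.update z i w) ≤ supDeviation μ ℓ z + c / n := by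
  have hn' : (0 : ℝ) < n := by exact_mod_cast hn
  refine ciSup_le_ciSup_add (bddAbove_range_of_abs_le fun h =>
    abs_integral_sub_average_le μ hC hn z h) fun h => ?_
  rw [sum_update_eq (fun _ v => ℓ h v)]
  have h2 := mul_le_mul_of_nonneg_left (neg_le_of_abs_le (hosc h (z i) w))
    (one_div_nonneg.2 hn'.le)
  have h3 : (1 / (n : ℝ)) * -c + c / n = 0 := by ring
  linarith

theorem integral_average_eq (hℓ : ∀ h, Measurable (ℓ h)) (hC : ∀ h z, |ℓ h z| ≤ c) {n : ℕ}
    (hn : 0 < n) (h : H) :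
    ∫ z, (1 / (n : ℝ)) * ∑ i, ℓ h (z i) ∂(Measure.pi fun _ : Fin n => μ) = ∫ w, ℓ h w ∂μ := by
  have hn' : (n : ℝ) ≠ 0 := by exact_mod_cast hn.ne'
  have hi : ∀ i : Fin n, ∫ z, ℓ h (z i) ∂(Measure.pi fun _ : Fin n => μ) = ∫ w, ℓ h w ∂μ := by
    intro i
    have := measurePreserving_eval (fun _ : Fin n => μ) i
    have hmap := integral_map (μ := Measure.pi fun _ : Fin n => μ) (f := ℓ h)
      this.measurable.aemeasurable (hℓ h).aestronglyMeasurable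
    rw [this.map_eq] at hmap
    exact hmap.symm
  rw [integral_const_mul, integral_finsetSum Finset.univ (f := fun i (z : Fin n → Z) => ℓ h (z i))
    fun i _ => integrable_of_abs_le ((hℓ h).comp (measurable_pi_apply i)) fun z => hC h _]
  simp [hi, hn']

theorem measurable_ghostSup [Countable H] (hℓ : ∀ h, Measurable (ℓ h)) {n : ℕ}
    (σ : Fin n → ℤˣ) : Measurable (ghostSup ℓ σ) := by
  unfold ghostSup
  exact Measurable.iSup fun h => Measurable.const_mul (Finset.measurable_sum _ fun i _ =>
    (((hℓ h).comp ((measurable_pi_apply i).comp measurable_fst)).sub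
      ((hℓ h).comp ((measurable_pi_apply i).comp measurable_snd))).const_mul _) _

/-- Exchanging the i-th point with its ghost preserves the joint law and flips the i-th sign.
Regrouping two samples as one sample of pairs makes the exchange act coordinatewise. -/
theorem integral_ghostSup_eq [Countable H] (hℓ : ∀ h, Measurable (ℓ h)) {n : ℕ}
    (σ : Fin n → ℤˣ) :
    ∫ q, ghostSup ℓ σ q ∂((Measure.pi fun _ : Fin n => μ).prod (Measure.pi fun _ : Fin n => μ)) =
      ∫ q, ghostSup ℓ 1 q
        ∂((Measure.pi fun _ : Fin n => μ).prod (Measure.pi fun _ : Fin n => μ)) := by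
  have hE := measurePreserving_arrowProdEquivProdArrow Z Z (Fin n) (fun _ => μ) (fun _ => μ)
  have hA : MeasurePreserving (fun (w : Fin n → Z × Z) i => if σ i = 1 then w i else (w i).swap)
      (Measure.pi fun _ => μ.prod μ) (Measure.pi fun _ => μ.prod μ) := by
    refine measurePreserving_pi (f := fun i (v : Z × Z) => if σ i = 1 then v else v.swap)
      (fun _ => μ.prod μ) (fun _ => μ.prod μ) fun i => ?_
    by_cases h : σ i = 1
    · simpa only [h, if_true] using! MeasurePreserving.id _
    · simpa only [h, if_false] using Measure.measurePreserving_swap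
  have hm := fun τ : Fin n → ℤˣ => measurable_ghostSup hℓ τ
  rw [← hE.integral_comp' , ← hE.integral_comp']
  set g : (Fin n → Z × Z) → ℝ := fun w =>
    ghostSup ℓ 1 (MeasurableEquiv.arrowProdEquivProdArrow Z Z (Fin n) w) with hg
  have hgm : Measurable g := (hm 1).comp (MeasurableEquiv.measurable _)
  conv_rhs => rw [← hA.map_eq, integral_map hA.measurable.aemeasurable hgm.aestronglyMeasurable]
  refine integral_congr_ae (Eventually.of_forall fun w => ?_)
  simp only [hg, ghostSup]
  congr 1
  funext h
  congr 1
  refine Finset.sum_congr rfl fun i _ => ?_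
  simp only [MeasurableEquiv.arrowProdEquivProdArrow, Equiv.arrowProdEquivProdArrow,
    MeasurableEquiv.coe_mk, Equiv.coe_fn_mk, Pi.one_apply]
  rcases Int.units_eq_one_or (σ i) with h1 | h1 <;> simp [h1]

/-- Symmetrization. -/
theorem integral_supDeviation_le [Nonempty H] [Countable H] (hℓ : ∀ h, Measurable (ℓ h))
    (hC : ∀ h z, |ℓ h z| ≤ c) (hosc : ∀ h z w, |ℓ h w - ℓ h z| ≤ c) {n : ℕ} (hn : 0 < n) :
    ∫ z, supDeviation μ ℓ z ∂(Measure.pi fun _ : Fin n => μ) ≤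
      2 * ∫ z, lossRademacher ℓ z ∂(Measure.pi fun _ : Fin n => μ) := by
  set P := Measure.pi fun _ : Fin n => μ
  have hgi : ∀ σ : Fin n → ℤˣ, Integrable (ghostSup ℓ σ) (P.prod P) := fun σ =>
    integrable_of_abs_le (measurable_ghostSup hℓ σ) (abs_ghostSup_le hosc hn σ)
  have hsi : ∀ σ : Fin n → ℤˣ, Integrable (signedSup ℓ σ) P := fun σ =>
    integrable_of_abs_le (measurable_signedSup hℓ σ) (abs_signedSup_le hC hn σ)
  -- The true mean is the average over a ghost sample `w`, and a supremum of integrals is at most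
  -- the integral of the supremum.
  have h1 : ∀ z, supDeviation μ ℓ z ≤ ∫ w, ghostSup ℓ 1 (w, z) ∂P := by
    intro z
    refine ciSup_le fun h => ?_
    have hai : Integrable (fun w : Fin n → Z => (1 / (n : ℝ)) * ∑ i, ℓ h (w i)) P :=
      integrable_of_abs_le (Measurable.const_mul
        (Finset.measurable_sum _ fun i _ => (hℓ h).comp (measurable_pi_apply i)) _)
        fun w => abs_average_le hn fun _ => hC h _
    have hconst : ∫ _w : Fin n → Z, (1 / (n : ℝ)) * ∑ i, ℓ h (z i) ∂P =
      (1 / (n : ℝ)) * ∑ i, ℓ h (z i) := by simp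
    rw [← integral_average_eq μ hℓ hC hn h, ← hconst, ← integral_sub hai (integrable_const _)]
    refine integral_mono (hai.sub (integrable_const _))
      (integrable_of_abs_le ((measurable_ghostSup hℓ 1).comp measurable_prodMk_right)
        fun w => abs_ghostSup_le hosc hn 1 _) fun w => ?_
    refine le_trans (le_of_eq ?_) (le_ciSup (f := fun h => (1 / (n : ℝ)) *
      ∑ i, (((1 : Fin n → ℤˣ) i : ℤ) : ℝ) * (ℓ h (w i) - ℓ h (z i)))
      (bddAbove_range_of_abs_le fun h =>
        abs_signed_average_le hn 1 fun _ => hosc h _ _) h)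
    simp [Finset.sum_sub_distrib, mul_sub]
  have h2 : ∫ z, supDeviation μ ℓ z ∂P ≤ ∫ q, ghostSup ℓ 1 q ∂(P.prod P) := by
    rw [integral_prod_symm _ (hgi 1)]
    refine integral_mono (integrable_of_abs_le (measurable_supDeviation μ hℓ) fun z =>
      abs_ciSup_le fun h => abs_integral_sub_average_le μ hC hn z h) ?_ h1
    exact (hgi 1).integral_prod_right
  -- All sign patterns have the same integral, so one of them may be replaced by the sum over all
  -- 2^n.
  have h3 : 2 ^ n * ∫ q, ghostSup ℓ 1 q ∂(P.prod P) ≤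
      2 ^ n * (2 * ∫ z, lossRademacher ℓ z ∂P) := by
    have e1 : 2 ^ n * ∫ q, ghostSup ℓ 1 q ∂(P.prod P) =
        ∑ σ : Fin n → ℤˣ, ∫ q, ghostSup ℓ σ q ∂(P.prod P) := by
      simp only [P, integral_ghostSup_eq μ hℓ]
      simp [Finset.card_univ]
    have e2 : 2 ^ n * (2 * ∫ z, lossRademacher ℓ z ∂P) =
        ∑ σ : Fin n → ℤˣ, (∫ z, signedSup ℓ σ z ∂P + ∫ z, signedSup ℓ (-σ) z ∂P) := by
      have hneg : ∑ σ : Fin n → ℤˣ, ∫ z, signedSup ℓ (-σ) z ∂P =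
          ∑ σ : Fin n → ℤˣ, ∫ z, signedSup ℓ σ z ∂P :=
        Equiv.sum_comp (Equiv.neg (Fin n → ℤˣ)) fun σ => ∫ z, signedSup ℓ σ z ∂P
      rw [Finset.sum_add_distrib, hneg]
      simp only [lossRademacher, integral_div]
      rw [integral_finsetSum _ fun σ _ => hsi σ]
      field_simp
      ring
    rw [e1, e2]
    refine Finset.sum_le_sum fun σ _ => ?_
    have e3 : ∫ z, signedSup ℓ σ z ∂P = ∫ q, signedSup ℓ σ q.1 ∂(P.prod P) := by
      simp [integral_fun_fst]
    have e4 : ∫ z, signedSup ℓ (-σ) z ∂P = ∫ q, signedSup ℓ (-σ) q.2 ∂(P.prod P) := by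
      simp [integral_fun_snd]
    rw [e3, e4, ← integral_add ((hsi σ).comp_fst P) ((hsi (-σ)).comp_snd P)]
    exact integral_mono (hgi σ) (((hsi σ).comp_fst P).add ((hsi (-σ)).comp_snd P))
      fun q => ghostSup_le hC hn σ q
  exact h2.trans (le_of_mul_le_mul_left h3 (by positivity))

/-- Data-dependent uniform deviation bound for a countable class of functions with values in
`[0, c]`. -/
theorem measure_uniformDeviation_le [Nonempty H] [Countable H] (hℓ : ∀ h, Measurable (ℓ h)) (hc : 0 < c)
    (h01 : ∀ h z, ℓ h z ∈ Set.Icc 0 c) {n : ℕ} (hn : 0 < n) {δ : ℝ} (hδ₀ : 0 < δ) (hδ₁ : δ < 1) :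
    (Measure.pi fun _ : Fin n => μ) {z | ¬ ∀ h, ∫ w, ℓ h w ∂μ ≤
      (1 / (n : ℝ)) * ∑ i, ℓ h (z i) + 2 * lossRademacher ℓ z
        + 3 * c * √(Real.log (1 / δ) / (2 * n))} ≤ ENNReal.ofReal δ := by
  have hn' : (0 : ℝ) < n := by exact_mod_cast hn
  have hC : ∀ h z, |ℓ h z| ≤ c := fun h z => by
    rw [abs_of_nonneg (h01 h z).1]; exact (h01 h z).2
  have hosc : ∀ h z w, |ℓ h w - ℓ h z| ≤ c := fun h z w => by
    have h1 := h01 h z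
    have h2 := h01 h w
    exact abs_le.2 ⟨by linarith [h1.2, h2.1], by linarith [h2.2, h1.1]⟩
  set ε := 3 * c * √(Real.log (1 / δ) / (2 * n)) with hε
  have hlog : 0 ≤ Real.log (1 / δ) := Real.log_nonneg (by rw [le_div_iff₀ hδ₀]; linarith)
  have hdevC : ∀ z : Fin n → Z, |supDeviation μ ℓ z| ≤ c + c := fun z =>
    abs_ciSup_le fun h => abs_integral_sub_average_le μ hC hn z h
  have hfm : Measurable fun z : Fin n → Z => supDeviation μ ℓ z - 2 * lossRademacher ℓ z :=
    (measurable_supDeviation μ hℓ).sub ((measurable_lossRademacher hℓ).const_mul 2)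
  -- The increment is c/n from the deviation plus 2c/n from twice the complexity.
  have key := measure_ge_le_of_boundedDifferences μ hn (c := 3 * c / n) (C := c + c + 2 * c)
    (ε := ε) (by positivity) (by positivity) hfm
    (fun z => (abs_sub _ _).trans (add_le_add (hdevC z) (by
      rw [abs_mul, abs_two]
      exact mul_le_mul_of_nonneg_left (abs_lossRademacher_le hC hn z) (by norm_num))))
    (fun z i w => by
      have h1 := supDeviation_update_le μ hC hosc hn z i w
      have h2 := lossRademacher_le_update hC hosc hn z i w
      have h3 : 3 * c / n = c / n + 2 * (c / n) := by ring
      linarith)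
    (by
      rw [integral_sub (integrable_of_abs_le (measurable_supDeviation μ hℓ) hdevC)
        ((integrable_of_abs_le (measurable_lossRademacher hℓ)
          (abs_lossRademacher_le hC hn)).const_mul 2), integral_const_mul]
      linarith [integral_supDeviation_le μ hℓ hC hosc hn])
  have hexp : Real.exp (-(2 * ε ^ 2 / (n * (3 * c / n) ^ 2))) = δ := by
    have : 2 * ε ^ 2 / (n * (3 * c / n) ^ 2) = Real.log (1 / δ) := by
      rw [hε, mul_pow, Real.sq_sqrt (by positivity)]
      field_simp
    rw [this, one_div, Real.log_inv, neg_neg, Real.exp_log hδ₀]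
  rw [hexp] at key
  refine (measure_mono fun z hz => ?_).trans key
  simp only [Set.mem_ofPred_eq, not_forall, not_le] at hz ⊢
  obtain ⟨h, hh⟩ := hz
  have := le_ciSup (f := fun h => ∫ w, ℓ h w ∂μ - (1 / (n : ℝ)) * ∑ i, ℓ h (z i))
    (bddAbove_range_of_abs_le fun h => abs_integral_sub_average_le μ hC hn z h) h
  change _ ≤ supDeviation μ ℓ z at this
  linarith

end UniformDeviation

/-! ### Losses of randomized explainers -/

namespace LocalExplain

variable {X : Type*}

/-- Truncation of a label to `[-B, B]`. -/
noncomputable def truncLabel (B y : ℝ) : ℝ := max (-B) (min B y)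

theorem abs_truncLabel_le {B : ℝ} (hB : 0 < B) (y : ℝ) : |truncLabel B y| ≤ B :=
  abs_le.2 ⟨le_max_left _ _, max_le (by linarith) (min_le_left _ _)⟩

theorem truncLabel_of_mem {B y : ℝ} (hy : y ∈ Set.Icc (-B) B) : truncLabel B y = y := by
  rw [truncLabel, min_eq_right hy.2, max_eq_right hy.1]

theorem sq_sub_mem_Icc {B a b : ℝ} (ha : |a| ≤ B) (hb : |b| ≤ B) :
    (a - b) ^ 2 ∈ Set.Icc 0 (4 * B ^ 2) := by
  refine ⟨sq_nonneg _, ?_⟩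
  rw [show 4 * B ^ 2 = (2 * B) ^ 2 by ring]
  exact sq_le_sq' (by linarith [abs_le.1 ha, abs_le.1 hb]) (by linarith [abs_le.1 ha, abs_le.1 hb])

variable [MeasurableSpace X]

/-- The expected squared error of the randomized explainer at a labelled point, with the label
truncated to `[-B, B]`. -/
noncomputable def explainerLoss (B : ℝ) (N : Kernel X X) (g : X → X → ℝ) (z : X × ℝ) : ℝ :=
  ∫ x', (g x' z.1 - truncLabel B z.2) ^ 2 ∂(N z.1)

theorem measurable_truncLabel (B : ℝ) : Measurable (truncLabel B) :=
  measurable_const.max (measurable_const.min measurable_id)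

theorem measurable_section {g : X → X → ℝ} (hg : Measurable (Function.uncurry g)) (x : X) :
    Measurable fun x' => g x' x :=
  hg.comp measurable_prodMk_right

theorem measurable_explainerLoss (B : ℝ) (N : Kernel X X) [IsMarkovKernel N] {g : X → X → ℝ}
    (hg : Measurable (Function.uncurry g)) : Measurable (explainerLoss B N g) := by
  have h : Measurable fun q : (X × ℝ) × X => (g q.2 q.1.1 - truncLabel B q.1.2) ^ 2 :=
    ((hg.comp (measurable_snd.prodMk (measurable_fst.comp measurable_fst))).sub
      ((measurable_truncLabel B).comp (measurable_snd.comp measurable_fst))).pow_const 2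
  exact (h.stronglyMeasurable.integral_kernel_prod_right'
    (κ := N.comap Prod.fst measurable_fst)).measurable

theorem integrable_sq_loss {B : ℝ} (κ : Measure X) [IsFiniteMeasure κ] {g : X → X → ℝ}
    (hg : Measurable (Function.uncurry g)) (hgB : ∀ x' x, |g x' x| ≤ B) (x : X) {b : ℝ}
    (hb : |b| ≤ B) : Integrable (fun x' => (g x' x - b) ^ 2) κ :=
  integrable_of_abs_le (((measurable_section hg x).sub_const b).pow_const 2) (C := 4 * B ^ 2)
    fun x' => by
      have := sq_sub_mem_Icc (hgB x' x) hb
      rw [abs_of_nonneg this.1]; exact this.2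

theorem explainerLoss_mem_Icc {B : ℝ} (hB : 0 < B) (N : Kernel X X) [IsMarkovKernel N]
    {g : X → X → ℝ} (hg : Measurable (Function.uncurry g)) (hgB : ∀ x' x, |g x' x| ≤ B)
    (z : X × ℝ) : explainerLoss B N g z ∈ Set.Icc 0 (4 * B ^ 2) := by
  refine ⟨integral_nonneg fun _ => sq_nonneg _, ?_⟩
  refine (integral_mono (g := fun _ => 4 * B ^ 2)
    (integrable_sq_loss (N z.1) hg hgB z.1 (abs_truncLabel_le hB z.2)) (integrable_const _)
    fun x' => (sq_sub_mem_Icc (hgB x' z.1) (abs_truncLabel_le hB z.2)).2).trans (by simp)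

theorem explainerLoss_le {B : ℝ} (N : Kernel X X) [IsMarkovKernel N]
    {g : X → X → ℝ} (hg : Measurable (Function.uncurry g)) (hgB : ∀ x' x, |g x' x| ≤ B)
    {f : X → ℝ} (hf : ∀ x, |f x| ≤ B) {z : X × ℝ} (hz : z.2 ∈ Set.Icc (-B) B) :
    explainerLoss B N g z ≤ 2 * (f z.1 - z.2) ^ 2 + 2 * mnfAt N f g z.1 := by
  rw [explainerLoss, truncLabel_of_mem hz, mnfAt]
  have h1 : Integrable (fun x' => (f z.1 - g x' z.1) ^ 2) (N z.1) := by
    simpa only [sub_sq_comm (f z.1)] using integrable_sq_loss (N z.1) hg hgB z.1 (hf z.1)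
  have h2 : ∫ x', (2 * (f z.1 - z.2) ^ 2 + 2 * (f z.1 - g x' z.1) ^ 2) ∂(N z.1) =
      2 * (f z.1 - z.2) ^ 2 + 2 * ∫ x', (f z.1 - g x' z.1) ^ 2 ∂(N z.1) := by
    rw [integral_add (integrable_const _) (h1.const_mul 2), integral_const_mul 2 fun x' => (f z.1 - g x' z.1) ^ 2]
    simp
  rw [← h2]
  refine integral_mono (integrable_sq_loss (N z.1) hg hgB z.1 (abs_le.2 hz))
    ((integrable_const _).add (h1.const_mul 2)) fun x' => ?_
  simp only
  -- The slack in (u - v)² ≤ 2u² + 2v² is exactly (u + v)².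
  nlinarith [sq_nonneg ((f z.1 - z.2) + (f z.1 - g x' z.1))]

/-- Bounded differences require a loss bounded everywhere, whereas labels are bounded only almost
surely; truncation changes nothing off a null set. -/
theorem explainerTestMSE_eq {B : ℝ} {D : Measure (X × ℝ)} (hD : ∀ᵐ z ∂D, z.2 ∈ Set.Icc (-B) B)
    (N : Kernel X X) (g : X → X → ℝ) : explainerTestMSE D N g = ∫ z, explainerLoss B N g z ∂D := by
  refine integral_congr_ae ?_
  filter_upwards [hD] with z hz
  rw [explainerLoss, truncLabel_of_mem hz]

theorem tendsto_explainerLoss {B : ℝ} (hB : 0 < B) (N : Kernel X X) [IsMarkovKernel N]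
    {u : ℕ → X → X → ℝ} {g : X → X → ℝ} (hu : ∀ n, Measurable (Function.uncurry (u n)))
    (huB : ∀ n x' x, |u n x' x| ≤ B) (z : X × ℝ)
    (hlim : ∀ᵐ x' ∂(N z.1), Tendsto (fun n => u n x' z.1) atTop (𝓝 (g x' z.1))) :
    Tendsto (fun n => explainerLoss B N (u n) z) atTop (𝓝 (explainerLoss B N g z)) := by
  refine tendsto_integral_of_dominated_convergence (fun _ => 4 * B ^ 2) (fun n =>
    (((measurable_section (hu n) z.1).sub_const _).pow_const 2).aestronglyMeasurable)
    (integrable_const _) (fun n => Eventually.of_forall fun x' => ?_) ?_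
  · have := sq_sub_mem_Icc (huB n x' z.1) (abs_truncLabel_le hB z.2)
    rw [Real.norm_eq_abs, abs_of_nonneg this.1]; exact this.2
  · filter_upwards [hlim] with x' hx'
    exact (hx'.sub_const _).pow 2

/-- One reference measure for all targets lets the sum over the sample go under a single integral in
`x'`. -/
theorem explainerLoss_eq_integral_density {B : ℝ} (ν : Measure X) [SigmaFinite ν]
    (N : Kernel X X) [IsMarkovKernel N] (hN : ∀ x, N x ≪ ν) (g : X → X → ℝ) (z : X × ℝ) :
    explainerLoss B N g z =
      ∫ x', mirDensity ν N z.1 x' * (g x' z.1 - truncLabel B z.2) ^ 2 ∂ν := by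
  rw [explainerLoss, ← integral_rnDeriv_smul (hN z.1)]
  rfl

theorem measurable_mirDensity (ν : Measure X) (N : Kernel X X) (x : X) :
    Measurable (mirDensity ν N x) :=
  (Measure.measurable_rnDeriv _ _).ennreal_toReal

theorem integrable_mirDensity (ν : Measure X) (N : Kernel X X) [IsMarkovKernel N] (x : X) :
    Integrable (mirDensity ν N x) ν :=
  Measure.integrable_toReal_rnDeriv

theorem mirDensity_nonneg (ν : Measure X) (N : Kernel X X) (x x' : X) :
    0 ≤ mirDensity ν N x x' :=
  ENNReal.toReal_nonneg

/-- For nonnegative densities, √(∑ p_i²) ≤ ∑ p_i, which is integrable. -/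
theorem integrable_sqrt_sum_mirDensity_sq (ν : Measure X) (N : Kernel X X) [IsMarkovKernel N]
    {m : ℕ} (x : Fin m → X) : Integrable (fun x' => √(∑ i, mirDensity ν N (x i) x' ^ 2)) ν := by
  refine (integrable_finsetSum Finset.univ fun i _ => integrable_mirDensity ν N (x i)).mono'
    (Finset.measurable_sum _ fun i _ =>
      (measurable_mirDensity ν N (x i)).pow_const 2).sqrt.aestronglyMeasurable
    (Eventually.of_forall fun x' => ?_)
  rw [Real.norm_eq_abs, abs_of_nonneg (Real.sqrt_nonneg _)]
  refine Real.sqrt_le_iff.2 ⟨Finset.sum_nonneg fun i _ => mirDensity_nonneg _ _ _ _, ?_⟩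
  exact Finset.sum_sq_le_sq_sum_of_nonneg fun i _ => mirDensity_nonneg _ _ _ _

theorem disjointedness_eq (ν : Measure X) (N : Kernel X X) {m : ℕ} (x : Fin m → X) :
    disjointedness ν N x = (√(m : ℝ))⁻¹ * ∫ x', √(∑ i, mirDensity ν N (x i) x' ^ 2) ∂ν := by
  rw [disjointedness, ← integral_const_mul]
  congr 1
  funext x'
  rw [Real.sqrt_mul (by positivity), one_div, Real.sqrt_inv]

/-- The Rademacher complexity of the losses of the randomized explainers, in terms of the
disjointedness factor and the corrected complexity of the local explanations. -/
theorem lossRademacher_explainerLoss_le {B : ℝ} (hB : 0 < B) (ν : Measure X) [SigmaFinite ν]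
    (N : Kernel X X) [IsMarkovKernel N] (hN : ∀ x, N x ≪ ν) {Gloc : Set (X → ℝ)}
    (hGloc : ∀ h ∈ Gloc, ∀ x, |h x| ≤ B) {ι : Type*} [Nonempty ι] [Countable ι]
    {g : ι → X → X → ℝ} (hg : ∀ j x', g j x' ∈ Gloc)
    (hgm : ∀ j, Measurable (Function.uncurry (g j))) {m : ℕ} (hm : 0 < m) (z : Fin m → X × ℝ) :
    lossRademacher (fun j => explainerLoss B N (g j)) z ≤
      4 * B * disjointedness ν N (fun i => (z i).1) *
        empRademacherStar Gloc (fun i => (z i).1) * (Real.log m + 1) := by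
  have hm' : (0 : ℝ) < m := by exact_mod_cast hm
  set x : Fin m → X := fun i => (z i).1
  set y : Fin m → ℝ := fun i => truncLabel B (z i).2
  have hy : ∀ i, |y i| ≤ B := fun i => abs_truncLabel_le hB _
  set p : Fin m → X → ℝ := fun i => mirDensity ν N (x i)
  have hp : ∀ i x', 0 ≤ p i x' := fun i x' => mirDensity_nonneg _ _ _ _
  have hpi : ∀ i, Integrable (p i) ν := fun i => integrable_mirDensity _ _ _
  have hpm : ∀ i, Measurable (p i) := fun i => measurable_mirDensity _ _ _
  set w : ι → Fin m → X → ℝ := fun j i x' => p i x' * (g j x' (x i) - y i) ^ 2 with hw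
  have hwm : ∀ j i, Measurable (w j i) := fun j i =>
    (hpm i).mul (((measurable_section (hgm j) (x i)).sub_const _).pow_const 2)
  have hwb : ∀ j i x', |w j i x'| ≤ p i x' * (4 * B ^ 2) := fun j i x' => by
    have := sq_sub_mem_Icc (hGloc _ (hg j x') (x i)) (hy i)
    rw [hw, abs_mul, abs_of_nonneg (hp i x'), abs_of_nonneg this.1]
    exact mul_le_mul_of_nonneg_left this.2 (hp i x')
  have hwi : ∀ j i, Integrable (w j i) ν := fun j i =>
    ((hpi i).mul_const (4 * B ^ 2)).mono' (hwm j i).aestronglyMeasurable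
      (Eventually.of_forall (hwb j i))
  have hsb : ∀ (σ : Fin m → ℤˣ) j x', |∑ i, ((σ i : ℤ) : ℝ) * w j i x'| ≤
      ∑ i, p i x' * (4 * B ^ 2) := fun σ j x' => by
    refine (Finset.abs_sum_le_sum_abs _ _).trans (Finset.sum_le_sum fun i _ => ?_)
    rw [abs_mul, abs_intUnits, one_mul]
    exact hwb j i x'
  -- The supremum taken separately at each source point, where it ranges over local functions in
  -- `Gloc`.
  set Ψ : (Fin m → ℤˣ) → X → ℝ := fun σ x' => ⨆ j, ∑ i, ((σ i : ℤ) : ℝ) * w j i x'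
  have hΨi : ∀ σ, Integrable (Ψ σ) ν := fun σ => by
    refine (integrable_finsetSum Finset.univ fun i _ => (hpi i).mul_const (4 * B ^ 2)).mono'
      (Measurable.iSup fun j => Finset.measurable_sum _ fun i _ =>
        (hwm j i).const_mul _).aestronglyMeasurable
      (Eventually.of_forall fun x' => abs_ciSup_le fun j => hsb σ j x')
  have h1 : ∀ σ : Fin m → ℤˣ, signedSup (fun j => explainerLoss B N (g j)) σ z ≤
      (1 / (m : ℝ)) * ∫ x', Ψ σ x' ∂ν := by
    intro σ
    refine ciSup_le fun j => mul_le_mul_of_nonneg_left ?_ (by positivity)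
    have e : ∑ i, ((σ i : ℤ) : ℝ) * explainerLoss B N (g j) (z i) =
        ∫ x', ∑ i, ((σ i : ℤ) : ℝ) * w j i x' ∂ν := by
      rw [integral_finsetSum _ fun i _ => (hwi j i).const_mul _]
      refine Finset.sum_congr rfl fun i _ => ?_
      rw [integral_const_mul, explainerLoss_eq_integral_density ν N hN]
    rw [e]
    refine integral_mono (integrable_finsetSum _ fun i _ => (hwi j i).const_mul _) (hΨi σ)
      fun x' => ?_
    exact le_ciSup (f := fun j => ∑ i, ((σ i : ℤ) : ℝ) * w j i x')
      (bddAbove_range_of_abs_le fun j => hsb σ j x') j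
  set K := 4 * B * ((2 ^ m * √(m : ℝ) * empRademacherStar Gloc x)) * (Real.log m + 1)
  have h2 : ∫ x', ∑ σ, Ψ σ x' ∂ν ≤ K * ∫ x', √(∑ i, p i x' ^ 2) ∂ν := by
    rw [← integral_const_mul]
    refine integral_mono (integrable_finsetSum _ fun σ _ => hΨi σ)
      ((integrable_sqrt_sum_mirDensity_sq ν N x).const_mul K) fun x' => ?_
    refine (sum_iSup_weighted_sq_le hm hB hGloc (a := fun j => g j x') (fun j => hg j x') x hy
      (fun i => hp i x')).trans (le_of_eq ?_)
    simp only [K]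
    ring
  rw [integral_finsetSum _ fun σ _ => hΨi σ] at h2
  have h3 : ∑ σ : Fin m → ℤˣ, signedSup (fun j => explainerLoss B N (g j)) σ z ≤
      (1 / (m : ℝ)) * (K * ∫ x', √(∑ i, p i x' ^ 2) ∂ν) := by
    refine (Finset.sum_le_sum fun σ _ => h1 σ).trans ?_
    rw [← Finset.mul_sum]
    exact mul_le_mul_of_nonneg_left h2 (by positivity)
  rw [lossRademacher, div_le_iff₀ (by positivity)]
  refine h3.trans (le_of_eq ?_)
  rw [disjointedness_eq]
  have hs : √(m : ℝ) * √(m : ℝ) = m := Real.mul_self_sqrt hm'.le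
  have hs0 : √(m : ℝ) ≠ 0 := by positivity
  simp only [K, p]
  generalize (∫ x', √(∑ i, mirDensity ν N (x i) x' ^ 2) ∂ν) = I
  field_simp
  rw [pow_two, hs]

end LocalExplain

/-! ### The generalization bound -/

theorem mainTheorem4 {X : Type*} [MeasurableSpace X]
    -- the reference measure `dx'` on the input space
    (ν : Measure X) [SigmaFinite ν]
    (B : ℝ) (hB : 0 < B)
    -- the data distribution, with labels in `[-B, B]`
    (D : Measure (X × ℝ)) [IsProbabilityMeasure D]
    (hD : ∀ᵐ z ∂D, z.2 ∈ Set.Icc (-B) B)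
    -- the mirrored neighborhood distributions, which have densities
    (N : Kernel X X) [IsMarkovKernel N] (hN : ∀ x, N x ≪ ν)
    -- the models, the local explanations and the explainers, all with values in `[-B, B]`
    (F : Set (X → ℝ)) (hF : ∀ f ∈ F, ∀ x, f x ∈ Set.Icc (-B) B)
    (Gloc : Set (X → ℝ)) (hGloc : ∀ h ∈ Gloc, ∀ x, h x ∈ Set.Icc (-B) B)
    (G : Set (X → X → ℝ)) (hG : ∀ g ∈ G, ∀ x', g x' ∈ Gloc)
    (hGmeas : ∀ g ∈ G, Measurable (Function.uncurry g))
    (hGsep : LocalExplain.IsSeparableClass N G)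
    (m : ℕ) (hm : 0 < m) (δ : ℝ) (hδ₀ : 0 < δ) (hδ₁ : δ < 1) :
    -- the (outer) probability that the bound fails for some `f` and `g` is at most `δ`
    (Measure.pi fun _ : Fin m => D)
      {S : Fin m → X × ℝ | ¬ ∀ f ∈ F, ∀ g ∈ G,
        LocalExplain.explainerTestMSE D N g ≤
          (2 / (m : ℝ)) * ∑ i, (f (S i).1 - (S i).2) ^ 2
          + (2 / (m : ℝ)) * ∑ i, LocalExplain.mnfAt N f g (S i).1
          + 8 * B * LocalExplain.disjointedness ν N (fun i => (S i).1)
              * LocalExplain.empRademacherStar Gloc (fun i => (S i).1) * (Real.log m + 1)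
          + 12 * B ^ 2 * √(Real.log (1 / δ) / (2 * m))}
      ≤ ENNReal.ofReal δ := by
  obtain ⟨G₀, hG₀, hcount, happrox⟩ := hGsep
  rcases G.eq_empty_or_nonempty with rfl | ⟨g₀, hg₀⟩
  · simp
  have hm' : (0 : ℝ) < m := by exact_mod_cast hm
  have : Nonempty G₀ := by
    obtain ⟨u, hu, -⟩ := happrox g₀ hg₀
    exact ⟨⟨u 0, hu 0⟩⟩
  have : Countable G₀ := hcount.to_subtype
  have hGlocB : ∀ h ∈ Gloc, ∀ x, |h x| ≤ B := fun h hh x => abs_le.2 (hGloc h hh x)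
  have hGB : ∀ g ∈ G, ∀ x' x, |g x' x| ≤ B := fun g hg x' x => hGlocB _ (hG g hg x') x
  set ℓ : G₀ → X × ℝ → ℝ := fun g => LocalExplain.explainerLoss B N g with hℓ
  have key := measure_uniformDeviation_le (ℓ := ℓ) (c := 4 * B ^ 2) D
    (fun g => LocalExplain.measurable_explainerLoss B N (hGmeas g (hG₀ g.2))) (by positivity)
    (fun g z => LocalExplain.explainerLoss_mem_Icc hB N (hGmeas g (hG₀ g.2)) (hGB g (hG₀ g.2)) z)
    hm hδ₀ hδ₁
  have hlabels : ∀ᵐ S ∂(Measure.pi fun _ : Fin m => D), ∀ i, (S i).2 ∈ Set.Icc (-B) B :=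
    ae_all_iff.2 fun i =>
      (measurePreserving_eval (fun _ : Fin m => D) i).quasiMeasurePreserving.ae hD
  -- Off the null set of samples with a label outside [-B, B], failure for some `f`, `g` forces
  -- failure of the uniform bound on `G₀`.
  refine (measure_mono_ae ?_).trans key
  filter_upwards [hlabels] with S hS
  refine fun hbad hgood => hbad fun f hf g hg => ?_
  obtain ⟨u, hu, hlim⟩ := happrox g hg
  have hum : ∀ n, Measurable (Function.uncurry (u n)) := fun n => hGmeas _ (hG₀ (hu n))
  have huB : ∀ n x' x, |u n x' x| ≤ B := fun n => hGB _ (hG₀ (hu n))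
  have hpt : ∀ z, Tendsto (fun n => LocalExplain.explainerLoss B N (u n) z) atTop
      (𝓝 (LocalExplain.explainerLoss B N g z)) := fun z =>
    LocalExplain.tendsto_explainerLoss hB N hum huB z (hlim z.1)
  have hmean : Tendsto (fun n => ∫ z, LocalExplain.explainerLoss B N (u n) z ∂D) atTop
      (𝓝 (∫ z, LocalExplain.explainerLoss B N g z ∂D)) := by
    refine tendsto_integral_of_dominated_convergence (fun _ => 4 * B ^ 2)
      (fun n => (LocalExplain.measurable_explainerLoss B N (hum n)).aestronglyMeasurable)
      (integrable_const _) (fun n => Eventually.of_forall fun z => ?_)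
      (Eventually.of_forall hpt)
    have := LocalExplain.explainerLoss_mem_Icc hB N (hum n) (huB n) z
    rw [Real.norm_eq_abs, abs_of_nonneg this.1]
    exact this.2
  -- The complexity and confidence terms do not depend on `n`, so the bound on `G₀` passes to the
  -- limit `g`.
  have hbound := le_of_tendsto_of_tendsto' hmean
    ((((tendsto_finsetSum Finset.univ fun i _ => hpt (S i)).const_mul (1 / (m : ℝ))).add_const
      (2 * lossRademacher ℓ S)).add_const (3 * (4 * B ^ 2) * √(Real.log (1 / δ) / (2 * m))))
    fun n => hgood ⟨u n, hu n⟩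
  have hrad := LocalExplain.lossRademacher_explainerLoss_le hB ν N hN hGlocB
    (g := fun j : G₀ => (j : X → X → ℝ)) (fun j x' => hG _ (hG₀ j.2) x')
    (fun j => hGmeas _ (hG₀ j.2)) hm S
  have hemp : (1 / (m : ℝ)) * ∑ i, LocalExplain.explainerLoss B N g (S i) ≤
      (2 / (m : ℝ)) * ∑ i, (f (S i).1 - (S i).2) ^ 2
        + (2 / (m : ℝ)) * ∑ i, LocalExplain.mnfAt N f g (S i).1 := by
    refine (mul_le_mul_of_nonneg_left (Finset.sum_le_sum fun i _ =>
      LocalExplain.explainerLoss_le N (hGmeas g hg) (hGB g hg) (fun x => abs_le.2 (hF f hf x))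
        (hS i)) (by positivity)).trans (le_of_eq ?_)
    rw [Finset.sum_add_distrib, ← Finset.mul_sum, ← Finset.mul_sum]
    ring
  rw [LocalExplain.explainerTestMSE_eq hD]
  -- Constants: 8B = 2 · 4B and 12B² = 3 · 4B².
  linarith
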